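/- Let $(M,g)$ be a smooth Riemannian manifold of dimension $d\ge 1$ (Hausdorff, second countable, without boundary), and let $\Omega\subset M$ be open, connected and bounded, in the sense that $\overline\Omega$ is compact, with smooth boundary if $\partial\Omega\neq\emptyset$. Let $dx_g$ be the Riemannian measure. If $\partial\Omega\ne\emptyset$, fix either the Dirichlet or the Neumann boundary condition. Set $X=L^2(\Omega)$ in the Dirichlet case, and $X=L^2_0(\Omega)=\{u\in L^2(\Omega):\int_\Omega u\,dx_g=0\}$ in the Neumann case and in the case $\partial\Omega=\emptyset$ (real-valued functions, $L^2$ norm). Let $A=-\Delta_g$ be the Laplace operator on $X$ with this boundary condition, that is, the positive selfadjoint operator associated with the form $(u,v)\mapsto\int_\Omega g(\nabla u,\nabla v)\,dx_g$ on $D(A^{1/2})$, where $D(A^{1/2})=H^1_0(\Omega)$ in the Dirichlet case and $D(A^{1/2})=H^1(\Omega)\cap L^2_0(\Omega)$ otherwise. The space $D(A^{1/2})$ has the norm $\|A^{1/2}u\|_{L^2(\Omega)}=\|\nabla u\|_{L^2(\Omega)}$, and its dual $D(A^{1/2})'$ with respect to the pivot space $X$ has the dual norm $\|A^{-1/2}u\|_{L^2(\Omega)}$.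 For $(u^0,u^1)\in D(A^{1/2})\times X$ (resp. $X\times D(A^{1/2})'$), let $u\in C^0(\mathbb R;D(A^{1/2}))\cap C^1(\mathbb R;X)$ (resp. $u\in C^0(\mathbb R;X)\cap C^1(\mathbb R;D(A^{1/2})')$) be the weak solution of $\partial_t^2u+Au=0$ with $u_{|t=0}=u^0$, $\partial_tu_{|t=0}=u^1$ (the equation holding in $D(A^{1/2})'$, resp. in $D(A)'$). Let $Q$ be an open subset of $\mathbb R\times\overline\Omega$, let $\omega(t)=\{x\in\Omega:(t,x)\in Q\}$, and let $T>0$. **Proposition.** The following are equivalent. 1. There is $C>0$ such that, for all $(u^0,u^1)\in D(A^{1/2})\times X$, the corresponding solution $u$ satisfies $$C\left(\|u^0\|_{D(A^{1/2})}^2+\|u^1\|_X^2\right)\le\int_0^T\!\!\int_{\omega(t)}|\partial_tu(t,x)|^2\,dx_g\,dt.$$ 2. There is $C>0$ such that, for all $(u^0,u^1)\in X\times D(A^{1/2})'$, the corresponding solution $u$ satisfies $$C\left(\|u^0\|_{X}^2+\|u^1\|_{D(A^{1/2})'}^2\right)\le\int_0^T\!\!\int_{\omega(t)}|u(t,x)|^2\,dx_g\,dt.$$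 -/

import Mathlib

open MeasureTheory Manifold Bundle Set
open scoped ContDiff ENNReal Topology

noncomputable section

namespace WaveObservability

section Geometry

variable {d : ℕ} {M : Type*} [TopologicalSpace M] [ChartedSpace (EuclideanSpace ℝ (Fin d)) M]

variable (d) in
/-- The open set `Ω` has a smooth boundary: near each of its boundary points there is a smooth
chart of the manifold in which `Ω` is an open half-space. The condition is void if the boundary is
empty. -/
def HasSmoothBoundary (Ω : Set M) : Prop :=
  ∀ p ∈ frontier Ω, ∃ e ∈ IsManifold.maximalAtlas (𝓡 d) ∞ M, p ∈ e.source ∧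
    ∃ i : Fin d, ∀ x ∈ e.source, x ∈ Ω ↔ 0 < e x i

/-- The coordinate vector field `∂ / ∂ xᵢ` of a chart `e`, at the point `x` of its domain. -/
def coordVec (e : OpenPartialHomeomorph M (EuclideanSpace ℝ (Fin d))) (x : M) (i : Fin d) :
    TangentSpace (𝓡 d) x :=
  mfderiv (𝓡 d) (𝓡 d) e.symm (e x) (EuclideanSpace.single i (1 : ℝ))

variable (d M) in
/-- A second countable manifold is covered by a sequence of charts. -/
theorem exists_chartCenters [SecondCountableTopology M] [Nonempty M] :
    ∃ p : ℕ → M, ∀ x : M, ∃ n, x ∈ (chartAt (EuclideanSpace ℝ (Fin d)) (p n)).source := by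
  obtain ⟨s, hs, hU⟩ := TopologicalSpace.countable_cover_nhds
    (fun x : M => chart_source_mem_nhds (EuclideanSpace ℝ (Fin d)) x)
  have hne : s.Nonempty := by
    rcases s.eq_empty_or_nonempty with h | h
    · exfalso
      have hx : (Classical.arbitrary M) ∈ (univ : Set M) := mem_univ _
      rw [← hU, h] at hx
      simp at hx
    · exact h
  obtain ⟨p, rfl⟩ := hs.exists_eq_range hne
  refine ⟨p, fun x => ?_⟩
  have hx : x ∈ (univ : Set M) := mem_univ _
  rw [← hU] at hx
  simpa using hx

variable [SecondCountableTopology M] [Nonempty M]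

variable (d M) in
/-- A sequence of charts that covers the manifold. -/
def coverChart (n : ℕ) : OpenPartialHomeomorph M (EuclideanSpace ℝ (Fin d)) :=
  chartAt (EuclideanSpace ℝ (Fin d)) ((exists_chartCenters d M).choose n)

theorem exists_mem_coverChart (x : M) : ∃ n, x ∈ (coverChart d M n).source :=
  (exists_chartCenters d M).choose_spec x

open Classical in
variable (d) in
/-- The index of the first chart of the covering sequence whose domain contains `x`. -/
def chartIndex (x : M) : ℕ := Nat.find (exists_mem_coverChart (d := d) x)

/-- The points for which the `n`-th chart is the first one to contain them. These sets form a
countable Borel partition of the manifold, the `n`-th one being inside the `n`-th chart. -/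
def piece (d : ℕ) (M : Type*) [TopologicalSpace M] [ChartedSpace (EuclideanSpace ℝ (Fin d)) M]
    [SecondCountableTopology M] [Nonempty M] (n : ℕ) : Set M := {x : M | chartIndex d x = n}

theorem mem_source_of_chartIndex (x : M) : x ∈ (coverChart d M (chartIndex d x)).source := by
  classical
  exact Nat.find_spec (exists_mem_coverChart (d := d) x)

variable [RiemannianBundle (fun x : M => TangentSpace (𝓡 d) x)]

/-- The matrix `g_ij` of the Riemannian metric in the chart `e`, at the point `x`. -/
def gramMatrix (e : OpenPartialHomeomorph M (EuclideanSpace ℝ (Fin d))) (x : M) :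
    Matrix (Fin d) (Fin d) ℝ :=
  Matrix.of fun i j => inner ℝ (coordVec e x i) (coordVec e x j)

/-- The Riemannian measure `dx_g`: on each piece of the partition, it is the measure
`√(det g_ij) dx¹ ⋯ dxᵈ` in the coordinates of the chart. (It does not depend on the charts.) -/
def riemannianMeasure (d : ℕ) (M : Type*) [TopologicalSpace M]
    [ChartedSpace (EuclideanSpace ℝ (Fin d)) M] [SecondCountableTopology M] [Nonempty M]
    [RiemannianBundle (fun x : M => TangentSpace (𝓡 d) x)] [MeasurableSpace M] : Measure M :=
  Measure.sum fun n =>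
    let e := coverChart d M n
    (((volume : Measure (EuclideanSpace ℝ (Fin d))).restrict
        (e.target ∩ e.symm ⁻¹' piece d M n)).withDensity
      fun y => ENNReal.ofReal (Real.sqrt (gramMatrix e (e.symm y)).det)).map e.symm

/-- A Borel orthonormal frame of the tangent bundle: the Gram-Schmidt orthonormalization of the
coordinate vector fields, in the first chart of the covering sequence that contains the point. -/
def frame (x : M) (i : Fin d) : TangentSpace (𝓡 d) x :=
  InnerProductSpace.gramSchmidtNormed ℝ
    (fun j => coordVec (coverChart d M (chartIndex d x)) x j) i

theorem coordVec_linearIndependent {d : ℕ} {M : Type*} [TopologicalSpace M]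
    [ChartedSpace (EuclideanSpace ℝ (Fin d)) M] [IsManifold (𝓡 d) ∞ M]
    (e : OpenPartialHomeomorph M (EuclideanSpace ℝ (Fin d)))
    (he : e ∈ atlas (EuclideanSpace ℝ (Fin d)) M) (x : M) (hx : x ∈ e.source) :
    LinearIndependent ℝ (coordVec e x) := by
  have h1 := (mdifferentiable_of_mem_atlas (I := 𝓡 d) he).symm.mfderiv_injective (x := e x)
    (e.map_source hx)
  have h2 : LinearIndependent ℝ (fun i : Fin d => EuclideanSpace.single i (1 : ℝ)) := by
    have h3 := (EuclideanSpace.basisFun (Fin d) ℝ).orthonormal.linearIndependent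
    have h4 : ⇑(EuclideanSpace.basisFun (Fin d) ℝ) =
        fun i : Fin d => EuclideanSpace.single i (1 : ℝ) := by
      funext i
      simp
    rwa [h4] at h3
  exact h2.map' (mfderiv (𝓡 d) (𝓡 d) e.symm (e x)).toLinearMap (LinearMap.ker_eq_bot.2 h1)

theorem frame_orthonormal [IsManifold (𝓡 d) ∞ M] (x : M) : Orthonormal ℝ (frame (d := d) x) :=
  InnerProductSpace.gramSchmidtNormed_orthonormal
    (coordVec_linearIndependent _ (chart_mem_atlas _ _) x (mem_source_of_chartIndex x))

/-- The gradient of a smooth function `φ`, given by its components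
`⟪∇φ, Eᵢ⟫ = dφ(Eᵢ)` in the orthonormal frame `(Eᵢ)`. In particular the Euclidean inner product of
`gradient φ x` and `gradient ψ x` is the Riemannian one of the gradients at `x`. -/
def gradient (φ : M → ℝ) (x : M) : EuclideanSpace ℝ (Fin d) :=
  WithLp.toLp 2 fun i => (mfderiv (𝓡 d) 𝓘(ℝ, ℝ) φ x (frame x i) : ℝ)

end Geometry

/-- The type of boundary condition. It plays no role if the boundary is empty. -/
inductive BoundaryCondition
  | dirichlet
  | neumann

section Spaces

variable {d : ℕ} {M : Type*} [TopologicalSpace M] [ChartedSpace (EuclideanSpace ℝ (Fin d)) M]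
  [SecondCountableTopology M] [Nonempty M]
  [RiemannianBundle (fun x : M => TangentSpace (𝓡 d) x)] [MeasurableSpace M]

variable (d) in
/-- The real space `L²(Ω)`. -/
abbrev L2 (Ω : Set M) : Type _ := Lp ℝ 2 ((riemannianMeasure d M).restrict Ω)

variable (d) in
/-- The space of square integrable vector fields on `Ω`, a vector field being given by its
components in the orthonormal frame `frame`. -/
abbrev L2Field (Ω : Set M) : Type _ :=
  Lp (EuclideanSpace ℝ (Fin d)) 2 ((riemannianMeasure d M).restrict Ω)

/-- Whether the Dirichlet condition is imposed on a nonempty boundary. -/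
def IsDirichlet (Ω : Set M) (bc : BoundaryCondition) : Prop :=
  bc = BoundaryCondition.dirichlet ∧ (frontier Ω).Nonempty

open Classical in
variable (d) in
/-- The space `X`: all of `L²(Ω)` in the Dirichlet case; otherwise the space `L²₀(Ω)` of the
functions with zero mean, that is, the orthogonal complement of the constants. -/
def stateSpace (Ω : Set M) (bc : BoundaryCondition) : Submodule ℝ (L2 d Ω) :=
  if IsDirichlet Ω bc then ⊤
  else (Submodule.span ℝ
    {f : L2 d Ω | ∃ c : ℝ, f =ᵐ[(riemannianMeasure d M).restrict Ω] fun _ => c})ᗮ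

variable (d) in
/-- Smooth functions that are dense in the Sobolev space under consideration: smooth functions
with compact support in `Ω` in the Dirichlet case, and smooth functions up to the boundary of `Ω`
otherwise. -/
def smoothCore (Ω : Set M) (bc : BoundaryCondition) : Set (M → ℝ) :=
  {φ | ContMDiff (𝓡 d) 𝓘(ℝ, ℝ) ∞ φ ∧
    (IsDirichlet Ω bc → HasCompactSupport φ ∧ tsupport φ ⊆ Ω)}

variable (d) in
/-- The Sobolev space `H¹₀(Ω)` in the Dirichlet case, and `H¹(Ω)` otherwise: the closure of the
smooth functions for the norm `(‖u‖² + ‖∇u‖²)^(1/2)`. An element is a pair `(u, ∇u)`. -/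
def sobolevSpace (Ω : Set M) (bc : BoundaryCondition) :
    Submodule ℝ (WithLp 2 (L2 d Ω × L2Field d Ω)) :=
  (Submodule.span ℝ {w : WithLp 2 (L2 d Ω × L2Field d Ω) | ∃ φ ∈ smoothCore d Ω bc,
    w.fst =ᵐ[(riemannianMeasure d M).restrict Ω] φ ∧
    w.snd =ᵐ[(riemannianMeasure d M).restrict Ω] gradient φ}).topologicalClosure

variable (d) in
/-- The form domain of the Laplace operator: `H¹₀(Ω)` in the Dirichlet case, `H¹(Ω) ∩ L²₀(Ω)`
otherwise. -/
def formDomain (Ω : Set M) (bc : BoundaryCondition) :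
    Submodule ℝ (WithLp 2 (L2 d Ω × L2Field d Ω)) :=
  sobolevSpace d Ω bc ⊓ (stateSpace d Ω bc).comap (WithLp.fstₗ 2 ℝ (L2 d Ω) (L2Field d Ω))

variable (d) in
/-- The space `D(A^{1/2})`, where `A = -Δ_g` is the Laplace operator on `X`. It is the form domain
of `A`, and its norm is `‖A^{1/2} u‖ = ‖∇u‖`, see the instance below. -/
def EnergySpace (Ω : Set M) (bc : BoundaryCondition) : Type _ := formDomain d Ω bc

namespace EnergySpace

variable {Ω : Set M} {bc : BoundaryCondition}

instance : AddCommGroup (EnergySpace d Ω bc) :=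
  inferInstanceAs (AddCommGroup (formDomain d Ω bc))

instance : Module ℝ (EnergySpace d Ω bc) :=
  inferInstanceAs (Module ℝ (formDomain d Ω bc))

/-- The weak gradient. -/
def grad : EnergySpace d Ω bc →ₗ[ℝ] L2Field d Ω :=
  (WithLp.sndₗ 2 ℝ (L2 d Ω) (L2Field d Ω)).comp (formDomain d Ω bc).subtype

/-- The inclusion of `D(A^{1/2})` in `X`. -/
def toState : EnergySpace d Ω bc →ₗ[ℝ] stateSpace d Ω bc :=
  LinearMap.codRestrict (stateSpace d Ω bc)
    ((WithLp.fstₗ 2 ℝ (L2 d Ω) (L2Field d Ω)).comp (formDomain d Ω bc).subtype)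
    (fun u => u.2.2)

/-- The norm of `D(A^{1/2})` is `‖A^{1/2} u‖ = ‖∇u‖`. -/
instance : SeminormedAddCommGroup (EnergySpace d Ω bc) :=
  SeminormedAddCommGroup.induced (EnergySpace d Ω bc) (L2Field d Ω) grad

instance : NormedSpace ℝ (EnergySpace d Ω bc) :=
  NormedSpace.induced ℝ (EnergySpace d Ω bc) (L2Field d Ω) grad

theorem norm_eq (u : EnergySpace d Ω bc) : ‖u‖ = ‖grad u‖ := rfl

end EnergySpace

open EnergySpace

variable (d) in
/-- The space `D(A^{1/2})'`, with the dual norm `‖A^{-1/2} w‖`. An element `u` of the pivot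
space `X` is identified with the linear form `φ ↦ ⟪u, φ⟫_X`. -/
abbrev DualEnergySpace (Ω : Set M) (bc : BoundaryCondition) : Type _ :=
  StrongDual ℝ (EnergySpace d Ω bc)

/-- `φ ∈ D(A)` and `A φ = f`, in the form sense: `∫_Ω ⟪∇φ, ∇ψ⟫ = ∫_Ω f ψ` for all
`ψ ∈ D(A^{1/2})`. By Green's formula this is `-Δ_g φ = f`, with the boundary condition: it is
contained in the form domain in the Dirichlet case, and it is natural in the Neumann case. -/
def IsLaplace {Ω : Set M} {bc : BoundaryCondition} (φ : EnergySpace d Ω bc)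
    (f : stateSpace d Ω bc) : Prop :=
  ∀ ψ : EnergySpace d Ω bc, inner ℝ (grad φ) (grad ψ) = inner ℝ f (toState ψ)

/-- `u ∈ C⁰(ℝ; D(A^{1/2})) ∩ C¹(ℝ; X)`, with time derivative `u'`, is a (weak) solution of the wave
equation `∂ₜ² u + A u = 0` in `D(A^{1/2})'`. -/
structure IsEnergySolution {Ω : Set M} {bc : BoundaryCondition}
    (u : ℝ → EnergySpace d Ω bc) (u' : ℝ → stateSpace d Ω bc) : Prop where
  continuous : Continuous u
  hasDerivAt : ∀ t, HasDerivAt (fun s => toState (u s)) (u' t) t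
  continuous_deriv : Continuous u'
  wave : ∀ (φ : EnergySpace d Ω bc) (t : ℝ),
    HasDerivAt (fun s => inner ℝ (u' s) (toState φ)) (-inner ℝ (grad (u t)) (grad φ)) t

/-- `u ∈ C⁰(ℝ; X) ∩ C¹(ℝ; D(A^{1/2})')`, with time derivative `u'`, is a (weak) solution of the wave
equation `∂ₜ² u + A u = 0` in `D(A)'`, where `A u` is the linear form `φ ↦ ⟪u, A φ⟫_X`.
As `u'` is continuous with values in `D(A^{1/2})'`, it is the time derivative of `u` in
`D(A^{1/2})'` if it is so when tested against each element of `D(A^{1/2})`. -/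
structure IsWeakSolution {Ω : Set M} {bc : BoundaryCondition}
    (u : ℝ → stateSpace d Ω bc) (u' : ℝ → DualEnergySpace d Ω bc) : Prop where
  continuous : Continuous u
  hasDerivAt : ∀ (φ : EnergySpace d Ω bc) (t : ℝ),
    HasDerivAt (fun s => inner ℝ (u s) (toState φ)) (u' t φ) t
  continuous_deriv : Continuous u'
  wave : ∀ (φ : EnergySpace d Ω bc) (f : stateSpace d Ω bc), IsLaplace φ f → ∀ t : ℝ,
    HasDerivAt (fun s => u' s φ) (-inner ℝ (u t) f) t

/-- The time slice `ω(t) = {x ∈ Ω | (t, x) ∈ Q}`. -/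
def slice (Q : Set (ℝ × M)) (Ω : Set M) (t : ℝ) : Set M := {x | x ∈ Ω ∧ (t, x) ∈ Q}

/-- The observation `∫₀ᵀ ∫_{ω(t)} |w(t,x)|² dx_g dt`. -/
def observation {Ω : Set M} {bc : BoundaryCondition} (Q : Set (ℝ × M)) (T : ℝ)
    (w : ℝ → stateSpace d Ω bc) : ℝ≥0∞ :=
  ∫⁻ t in Ioo 0 T, ∫⁻ x in slice Q Ω t, ‖(w t : L2 d Ω) x‖ₑ ^ 2 ∂(riemannianMeasure d M)

variable (d) in
/-- Observability of `∂ₜ u` on `Q` in time `T`, for initial data in `D(A^{1/2}) × X`. -/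
def EnergyObservable (Ω : Set M) (bc : BoundaryCondition) (Q : Set (ℝ × M)) (T : ℝ) : Prop :=
  ∃ C : ℝ, 0 < C ∧ ∀ (u₀ : EnergySpace d Ω bc) (u₁ : stateSpace d Ω bc)
    (u : ℝ → EnergySpace d Ω bc) (u' : ℝ → stateSpace d Ω bc),
    IsEnergySolution u u' → u 0 = u₀ → u' 0 = u₁ →
      ENNReal.ofReal (C * (‖u₀‖ ^ 2 + ‖u₁‖ ^ 2)) ≤ observation Q T u'

variable (d) in
/-- Observability of `u` on `Q` in time `T`, for initial data in `X × D(A^{1/2})'`. -/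
def WeakObservable (Ω : Set M) (bc : BoundaryCondition) (Q : Set (ℝ × M)) (T : ℝ) : Prop :=
  ∃ C : ℝ, 0 < C ∧ ∀ (u₀ : stateSpace d Ω bc) (u₁ : DualEnergySpace d Ω bc)
    (u : ℝ → stateSpace d Ω bc) (u' : ℝ → DualEnergySpace d Ω bc),
    IsWeakSolution u u' → u 0 = u₀ → u' 0 = u₁ →
      ENNReal.ofReal (C * (‖u₀‖ ^ 2 + ‖u₁‖ ^ 2)) ≤ observation Q T u

end Spaces

end WaveObservability

end

/-! Formally, differentiation in time maps energy solutions to weak solutions, with data `(u¹, -A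
u⁰)`, and `A` is an isometry from `D(A^{1/2})` into its dual. Hence the weak inequality applied to
`∂ₜu` is the energy inequality, with the same constant.

Conversely one would apply the energy inequality to `-A⁻¹ ∂ₜu`, whose time derivative is `u`. To
avoid any Poincaré inequality, `A⁻¹` is replaced by `(A + ε)⁻¹`, given by Lax-Milgram on the form
domain with the graph norm. Then `-(A + ε)⁻¹ ∂ₜu` is an energy solution with derivative `u - ε (A +
ε)⁻¹ u` (`IsWeakSolution.isEnergySolution_resolvent`). As `ε → 0` the correction tends to the
projection of `u` on `ker A` (`GraphCoercive.exists_kernel_projection`), which is constant in time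
(`IsWeakSolution.inner_kernel_eq`) and is restored by adding `t • φ` with `φ` in the kernel. The
inequality then passes to the limit: the observations converge up to a factor 2 (`observation_le`),
and the dual norm of `∂ₜu` at time 0 is recovered from below (`eventually_le_norm_resolvent`). -/

noncomputable section

namespace WaveObservability

/-! ### The resolvent of the operator of a form, and its limit as `ε → 0`. -/

section Resolvent

variable {H X G : Type*} [NormedAddCommGroup H] [InnerProductSpace ℝ H]
  [NormedAddCommGroup X] [InnerProductSpace ℝ X] [NormedAddCommGroup G] [InnerProductSpace ℝ G]

/-- The form `⟪g φ, g ψ⟫ + ε ⟪ι φ, ι ψ⟫` of the operator `A + ε`. -/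
def shiftedForm (ι : H →L[ℝ] X) (g : H →L[ℝ] G) (ε : ℝ) : H →L[ℝ] H →L[ℝ] ℝ :=
  (innerSL ℝ).bilinearComp g g + ε • (innerSL ℝ).bilinearComp ι ι

theorem shiftedForm_apply (ι : H →L[ℝ] X) (g : H →L[ℝ] G) (ε : ℝ) (φ ψ : H) :
    shiftedForm ι g ε φ ψ = inner ℝ (g φ) (g ψ) + ε * inner ℝ (ι φ) (ι ψ) := by
  simp [shiftedForm]

/-- The norm of `H` is controlled by the graph norm of `g`. -/
def GraphCoercive (ι : H →L[ℝ] X) (g : H →L[ℝ] G) : Prop :=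
  ∀ h, ‖h‖ ^ 2 ≤ ‖ι h‖ ^ 2 + ‖g h‖ ^ 2

variable {ι : H →L[ℝ] X} {g : H →L[ℝ] G} {ε : ℝ}

theorem GraphCoercive.isCoercive (hc : GraphCoercive ι g) (hε : 0 < ε) :
    IsCoercive (shiftedForm ι g ε) := by
  refine ⟨min 1 ε, lt_min one_pos hε, fun h => ?_⟩
  rw [shiftedForm_apply, real_inner_self_eq_norm_sq, real_inner_self_eq_norm_sq, mul_assoc, ← sq]
  calc min 1 ε * ‖h‖ ^ 2 ≤ min 1 ε * (‖ι h‖ ^ 2 + ‖g h‖ ^ 2) :=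
        mul_le_mul_of_nonneg_left (hc h) (lt_min one_pos hε).le
    _ = min 1 ε * ‖g h‖ ^ 2 + min 1 ε * ‖ι h‖ ^ 2 := by ring
    _ ≤ 1 * ‖g h‖ ^ 2 + ε * ‖ι h‖ ^ 2 := by
        gcongr
        · exact min_le_left _ _
        · exact min_le_right _ _
    _ = _ := by ring

/-- Solutions of `(A + ε) φ = ℓ` are unique. -/
theorem GraphCoercive.shiftedForm_injective (hc : GraphCoercive ι g) (hε : 0 < ε) {φ φ' : H}
    (h : ∀ ψ, shiftedForm ι g ε φ ψ = shiftedForm ι g ε φ' ψ) : φ = φ' := by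
  obtain ⟨C, hC, hcoer⟩ := hc.isCoercive hε
  have h1 := hcoer (φ - φ')
  have h2 : shiftedForm ι g ε (φ - φ') (φ - φ') = 0 := by
    rw [map_sub (shiftedForm ι g ε), sub_apply, h, sub_self]
  rw [h2, mul_assoc] at h1
  have h3 : ‖φ - φ'‖ * ‖φ - φ'‖ ≤ 0 := nonpos_of_mul_nonpos_right h1 hC
  exact sub_eq_zero.1 (norm_eq_zero.1 (mul_self_eq_zero.1 (le_antisymm h3 (mul_self_nonneg _))))

variable [CompleteSpace H]

/-- Lax-Milgram, composed with the Riesz identification of the dual. -/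
theorem GraphCoercive.exists_resolvent (hc : GraphCoercive ι g) (hε : 0 < ε) :
    ∃ R : StrongDual ℝ H →L[ℝ] H, ∀ ℓ ψ, shiftedForm ι g ε (R ℓ) ψ = ℓ ψ := by
  refine ⟨((hc.isCoercive hε).continuousLinearEquivOfBilin.symm : H →L[ℝ] H).comp
    (LinearMap.mkContinuous (σ := RingHom.id ℝ)
      { toFun := (InnerProductSpace.toDual ℝ H).symm
        map_add' := map_add _
        map_smul' := fun c ℓ => by simp } 1 fun ℓ => by simp), fun ℓ ψ => ?_⟩
  rw [← (hc.isCoercive hε).continuousLinearEquivOfBilin_apply]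
  simp

open Classical in
variable (ι g ε) in
/-- The resolvent `(A + ε)⁻¹`, as a map from the dual of the form domain to the form domain. -/
def resolvent : StrongDual ℝ H →L[ℝ] H :=
  if h : ∃ R : StrongDual ℝ H →L[ℝ] H, ∀ ℓ ψ, shiftedForm ι g ε (R ℓ) ψ = ℓ ψ then h.choose else 0

theorem GraphCoercive.shiftedForm_resolvent (hc : GraphCoercive ι g) (hε : 0 < ε)
    (ℓ : StrongDual ℝ H) (ψ : H) : shiftedForm ι g ε (resolvent ι g ε ℓ) ψ = ℓ ψ := by
  rw [resolvent, dif_pos (hc.exists_resolvent hε)]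
  exact (hc.exists_resolvent hε).choose_spec ℓ ψ

variable (ι g ε) in
/-- The resolvent `(A + ε)⁻¹`, as a map from the pivot space to the form domain. -/
def pivotResolvent : X →L[ℝ] H :=
  (resolvent ι g ε).comp ((innerSL ℝ).bilinearComp (ContinuousLinearMap.id ℝ X) ι)

theorem GraphCoercive.shiftedForm_pivotResolvent (hc : GraphCoercive ι g) (hε : 0 < ε)
    (x : X) (ψ : H) :
    shiftedForm ι g ε (pivotResolvent ι g ε x) ψ = inner ℝ x (ι ψ) := by
  rw [pivotResolvent, ContinuousLinearMap.comp_apply, hc.shiftedForm_resolvent hε]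
  simp

/-- This is the weak form of `A (A + ε)⁻¹ x = x - ε (A + ε)⁻¹ x`. -/
theorem GraphCoercive.inner_grad_pivotResolvent (hc : GraphCoercive ι g) (hε : 0 < ε)
    (x : X) (ψ : H) :
    inner ℝ (g (pivotResolvent ι g ε x)) (g ψ) =
      inner ℝ (x - ε • ι (pivotResolvent ι g ε x)) (ι ψ) := by
  have h := hc.shiftedForm_pivotResolvent hε x ψ
  rw [shiftedForm_apply] at h
  rw [inner_sub_left, real_inner_smul_left]
  linarith

/-- The form is symmetric, and both sides are its value at the two resolvents. The resolvent on the
dual is thus the transpose of the one on the pivot space. -/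
theorem GraphCoercive.inner_resolvent (hc : GraphCoercive ι g) (hε : 0 < ε)
    (ℓ : StrongDual ℝ H) (x : X) :
    inner ℝ (ι (resolvent ι g ε ℓ)) x = ℓ (pivotResolvent ι g ε x) := by
  rw [← hc.shiftedForm_resolvent hε, real_inner_comm, ← hc.shiftedForm_pivotResolvent hε,
    shiftedForm_apply, shiftedForm_apply, real_inner_comm (g _), real_inner_comm (ι _)]

theorem GraphCoercive.inner_pivotResolvent_comm (hc : GraphCoercive ι g) (hε : 0 < ε) (x y : X) :
    inner ℝ (ι (pivotResolvent ι g ε x)) y = inner ℝ x (ι (pivotResolvent ι g ε y)) := by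
  rw [← hc.shiftedForm_pivotResolvent hε, real_inner_comm, ← hc.shiftedForm_pivotResolvent hε,
    shiftedForm_apply, shiftedForm_apply, real_inner_comm (g _), real_inner_comm (ι _)]

theorem GraphCoercive.inner_smul_pivotResolvent (hc : GraphCoercive ι g) (hε : 0 < ε) (x y : X) :
    inner ℝ (ε • ι (pivotResolvent ι g ε x)) y = ε * inner ℝ x (ι (pivotResolvent ι g ε y)) := by
  rw [real_inner_smul_left, hc.inner_pivotResolvent_comm hε]

theorem GraphCoercive.inner_sub_smul_pivotResolvent_comm (hc : GraphCoercive ι g) (hε : 0 < ε)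
    (x y : X) : inner ℝ (x - ε • ι (pivotResolvent ι g ε x)) y =
      inner ℝ x (y - ε • ι (pivotResolvent ι g ε y)) := by
  rw [inner_sub_left, inner_sub_right, hc.inner_smul_pivotResolvent hε, real_inner_smul_right]

/-- Test the equation of `y = (A + ε)⁻¹ x` against `y` itself and drop the gradient term. -/
theorem GraphCoercive.norm_smul_pivotResolvent_le (hc : GraphCoercive ι g) (hε : 0 < ε) (x : X) :
    ‖ε • ι (pivotResolvent ι g ε x)‖ ≤ ‖x‖ := by
  set y := pivotResolvent ι g ε x with hy
  have h := hc.shiftedForm_pivotResolvent hε x y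
  rw [← hy, shiftedForm_apply, real_inner_self_eq_norm_sq, real_inner_self_eq_norm_sq] at h
  have h1 := real_inner_le_norm x (ι y)
  rw [norm_smul, Real.norm_of_nonneg hε.le]
  rcases (norm_nonneg (ι y)).eq_or_lt with h0 | h0
  · rw [← h0]; simp
  · refine le_of_mul_le_mul_right ?_ h0
    nlinarith [sq_nonneg ‖g y‖]

/-- The same test, now dropping the zero-order term. The factor `ε` makes the remainder vanish in
`eventually_le_norm_resolvent`. -/
theorem GraphCoercive.norm_grad_smul_pivotResolvent_sq_le (hc : GraphCoercive ι g) (hε : 0 < ε)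
    (x : X) : ‖g (ε • pivotResolvent ι g ε x)‖ ^ 2 ≤ ε * ‖x‖ ^ 2 := by
  have hle := hc.norm_smul_pivotResolvent_le hε x
  set y := pivotResolvent ι g ε x with hy
  have h := hc.shiftedForm_pivotResolvent hε x y
  rw [← hy, shiftedForm_apply, real_inner_self_eq_norm_sq, real_inner_self_eq_norm_sq] at h
  have h1 := real_inner_le_norm x (ι y)
  rw [norm_smul, Real.norm_of_nonneg hε.le] at hle
  rw [map_smul, norm_smul, Real.norm_of_nonneg hε.le, mul_pow]
  calc ε ^ 2 * ‖g y‖ ^ 2 ≤ ε ^ 2 * (‖x‖ * ‖ι y‖) := by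
        gcongr
        nlinarith [mul_nonneg hε.le (sq_nonneg ‖ι y‖)]
    _ = ε * (‖x‖ * (ε * ‖ι y‖)) := by ring
    _ ≤ ε * (‖x‖ * ‖x‖) := by gcongr
    _ = _ := by ring

/-- On the kernel of `A`, the operators `ε (A + ε)⁻¹` are the identity. -/
theorem GraphCoercive.smul_pivotResolvent_of_grad_eq_zero (hc : GraphCoercive ι g) (hε : 0 < ε)
    {φ : H} (hφ : g φ = 0) : ε • pivotResolvent ι g ε (ι φ) = φ := by
  refine hc.shiftedForm_injective hε fun ψ => ?_
  rw [map_smul, smul_apply, hc.shiftedForm_pivotResolvent hε,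
    shiftedForm_apply, hφ]
  simp

variable [CompleteSpace X]

/-- On the orthogonal complement of the kernel of `A`, the operators `ε (A + ε)⁻¹` converge
strongly to `0` as `ε` tends to `0`. -/
theorem GraphCoercive.tendsto_smul_pivotResolvent_zero (hc : GraphCoercive ι g) {x : X}
    (hx : ∀ φ, g φ = 0 → inner ℝ x (ι φ) = 0) :
    Filter.Tendsto (fun ε : ℝ => ε • ι (pivotResolvent ι g ε x)) (𝓝[>] 0) (𝓝 0) := by
  -- `S = A (A + 1)⁻¹` is bounded, self-adjoint, and has the same kernel as `A`. So `x` lies in the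
  -- closure of its range, and by the uniform bound on `ε (A + ε)⁻¹` it suffices to treat that
  -- range.
  set S : X →L[ℝ] X := ContinuousLinearMap.id ℝ X - ι.comp (pivotResolvent ι g 1) with hS
  have hSa : S.adjoint = S := by
    refine Eq.symm ((ContinuousLinearMap.eq_adjoint_iff S S).2 fun a b => ?_)
    simp only [hS, sub_apply, ContinuousLinearMap.id_apply,
      ContinuousLinearMap.comp_apply, inner_sub_left, inner_sub_right]
    rw [hc.inner_pivotResolvent_comm one_pos]
  have hker : x ∈ S.kerᗮ := by
    rw [Submodule.mem_orthogonal']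
    intro k hk
    have hk' : k = ι (pivotResolvent ι g 1 k) := by
      have : S k = 0 := hk
      exact sub_eq_zero.1 this
    rw [hk']
    refine hx _ ?_
    have h := hc.inner_grad_pivotResolvent one_pos k (pivotResolvent ι g 1 k)
    rw [one_smul, ← hk', sub_self, inner_zero_left] at h
    exact inner_self_eq_zero.1 h
  rw [ContinuousLinearMap.orthogonal_ker, hSa] at hker
  rw [Metric.tendsto_nhds]
  intro η hη
  obtain ⟨y, ⟨f, rfl⟩, hy⟩ := Metric.mem_closure_iff.1 hker (η / 2) (half_pos hη)
  have hpos : ∀ᶠ ε : ℝ in 𝓝[>] 0, 0 < ε := self_mem_nhdsWithin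
  have hsmall : ∀ᶠ ε : ℝ in 𝓝[>] 0, ε * (2 * ‖ι (pivotResolvent ι g 1 f)‖) < η / 2 := by
    have : Filter.Tendsto (fun ε : ℝ => ε * (2 * ‖ι (pivotResolvent ι g 1 f)‖)) (𝓝[>] 0)
        (𝓝 (0 * (2 * ‖ι (pivotResolvent ι g 1 f)‖))) :=
      (Filter.tendsto_id.mul_const _).mono_left nhdsWithin_le_nhds
    rw [zero_mul] at this
    exact this.eventually (gt_mem_nhds (half_pos hη))
  filter_upwards [hpos, hsmall] with ε hε hsm
  set φ := pivotResolvent ι g 1 f with hφ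
  -- Since `S f = A φ`, this is `(A + ε)⁻¹ A = 1 - ε (A + ε)⁻¹`; it gives a bound of order `ε`.
  have key : pivotResolvent ι g ε (S f) = φ - ε • pivotResolvent ι g ε (ι φ) := by
    refine hc.shiftedForm_injective hε fun ψ => ?_
    have hlin : ∀ a b, shiftedForm ι g ε (a - ε • b) ψ =
        shiftedForm ι g ε a ψ - ε * shiftedForm ι g ε b ψ := fun a b => by simp
    rw [hc.shiftedForm_pivotResolvent hε, hlin, hc.shiftedForm_pivotResolvent hε, shiftedForm_apply,
      hc.inner_grad_pivotResolvent one_pos, ← hφ, one_smul]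
    simp [hS, hφ]
  have h1 : ‖ε • ι (pivotResolvent ι g ε (S f))‖ ≤ ε * (2 * ‖ι φ‖) := by
    rw [key, norm_smul, Real.norm_of_nonneg hε.le, map_sub, map_smul]
    gcongr
    calc _ ≤ ‖ι φ‖ + ‖ε • ι (pivotResolvent ι g ε (ι φ))‖ := norm_sub_le _ _
      _ ≤ ‖ι φ‖ + ‖ι φ‖ := by gcongr; exact hc.norm_smul_pivotResolvent_le hε _
      _ = _ := by ring
  have h2 := hc.norm_smul_pivotResolvent_le hε (x - S f)
  rw [map_sub, map_sub, smul_sub] at h2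
  have hy' : ‖x - S f‖ < η / 2 := by rw [← dist_eq_norm]; exact hy
  rw [dist_zero_right]
  calc _ ≤ ‖ε • ι (pivotResolvent ι g ε x) - ε • ι (pivotResolvent ι g ε (S f))‖
        + ‖ε • ι (pivotResolvent ι g ε (S f))‖ := norm_le_norm_sub_add _ _
    _ < η := by linarith

/-- The operators `ε (A + ε)⁻¹` converge strongly, as `ε` tends to `0`, to the projection on the
kernel of `A`. -/
theorem GraphCoercive.exists_kernel_projection (hc : GraphCoercive ι g) (x : X) :
    ∃ φ : H, g φ = 0 ∧
      Filter.Tendsto (fun ε : ℝ => ε • ι (pivotResolvent ι g ε x)) (𝓝[>] 0) (𝓝 (ι φ)) := by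
  set S : X →L[ℝ] X := ContinuousLinearMap.id ℝ X - ι.comp (pivotResolvent ι g 1) with hS
  have hcl : IsClosed (S.ker : Set X) := S.isClosed_ker
  have : CompleteSpace S.ker := hcl.completeSpace_coe
  set p : X := S.ker.starProjection x
  have hp : p = ι (pivotResolvent ι g 1 p) := by
    have : S p = 0 := S.ker.starProjection_apply_mem x
    exact sub_eq_zero.1 this
  set φ := pivotResolvent ι g 1 p with hφ
  have hgφ : g φ = 0 := by
    have h := hc.inner_grad_pivotResolvent one_pos p φ
    rw [one_smul, ← hφ, ← hp, sub_self, inner_zero_left] at h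
    exact inner_self_eq_zero.1 h
  refine ⟨φ, hgφ, ?_⟩
  have h0 := hc.tendsto_smul_pivotResolvent_zero (x := x - p) fun ψ hψ => by
    have hmem : ι ψ ∈ S.ker := by
      have := hc.smul_pivotResolvent_of_grad_eq_zero one_pos hψ
      rw [one_smul] at this
      simp [hS, this]
    exact Submodule.starProjection_inner_eq_zero x _ hmem
  have h1 := h0.add_const (ι φ)
  rw [zero_add] at h1
  refine h1.congr' ?_
  filter_upwards [self_mem_nhdsWithin] with ε hε
  have h2 : ε • ι (pivotResolvent ι g ε p) = ι φ := by
    rw [hp, ← map_smul, hc.smul_pivotResolvent_of_grad_eq_zero hε hgφ]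
  rw [map_sub, map_sub, smul_sub, h2, sub_add_cancel]

end Resolvent

theorem tendsto_enorm_sub_sq_zero {α E : Type*} [SeminormedAddCommGroup E] {l : Filter α}
    {f : α → E} {a : E} (h : Filter.Tendsto f l (𝓝 a)) :
    Filter.Tendsto (fun x => ‖f x - a‖ₑ ^ 2) l (𝓝 0) := by
  have h1 := ((ENNReal.continuous_pow 2).tendsto _).comp (h.sub_const a).enorm
  have h2 : ‖a - a‖ₑ ^ 2 = 0 := by simp [← ofReal_norm]
  exact Eq.subst (motive := fun z => Filter.Tendsto (fun x => ‖f x - a‖ₑ ^ 2) l (𝓝 z)) h2 h1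

/-- A continuous weak derivative is a derivative. -/
theorem hasDerivAt_of_forall_inner {X : Type*} [NormedAddCommGroup X] [InnerProductSpace ℝ X]
    [CompleteSpace X] {v w : ℝ → X} (hw : Continuous w)
    (h : ∀ (f : X) (t : ℝ), HasDerivAt (fun s => inner ℝ (v s) f) (inner ℝ (w t) f) t) (t : ℝ) :
    HasDerivAt v (w t) t := by
  have hV : ∀ t, HasDerivAt (fun t => v 0 + ∫ s in (0 : ℝ)..t, w s) (w t) t := fun t =>
    (hw.integral_hasStrictDerivAt 0 t).hasDerivAt.const_add _
  -- Tested against each `f`, the difference with the primitive of `w` has zero derivative.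
  have heq : v = fun t => v 0 + ∫ s in (0 : ℝ)..t, w s := by
    funext t
    refine ext_inner_right ℝ fun f => ?_
    have hd : ∀ s, HasDerivAt (fun s => inner ℝ (v s) f -
        inner ℝ (v 0 + ∫ r in (0 : ℝ)..s, w r) f) 0 s := fun s => by
      have h1 := (hV s).inner ℝ (hasDerivAt_const s f)
      simpa using! (h f s).sub h1
    have hcst := is_const_of_deriv_eq_zero (fun s => (hd s).differentiableAt)
      (fun s => (hd s).deriv) t 0
    simpa [sub_eq_zero] using hcst
  rw [heq]
  simpa using hV t

/-! ### The form domain as a Hilbert space, and the isometry `A`. -/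

section Wave

variable {d : ℕ} {M : Type*} [TopologicalSpace M] [ChartedSpace (EuclideanSpace ℝ (Fin d)) M]
  [SecondCountableTopology M] [Nonempty M]
  [RiemannianBundle (fun x : M => TangentSpace (𝓡 d) x)] [MeasurableSpace M]
  {Ω : Set M} {bc : BoundaryCondition}

open EnergySpace

theorem isClosed_stateSpace : IsClosed (stateSpace d Ω bc : Set (L2 d Ω)) := by
  unfold stateSpace
  split_ifs
  · exact isClosed_univ
  · exact Submodule.isClosed_orthogonal _

instance : CompleteSpace (stateSpace d Ω bc) := isClosed_stateSpace.completeSpace_coe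

/-- Lax-Milgram needs completeness, which is available for the graph norm; `EnergySpace` carries
only the seminorm of the gradient. -/
theorem isClosed_formDomain :
    IsClosed (formDomain d Ω bc : Set (WithLp 2 (L2 d Ω × L2Field d Ω))) :=
  (Submodule.isClosed_topologicalClosure _).inter
    (isClosed_stateSpace.preimage (WithLp.fstL 2 ℝ (L2 d Ω) (L2Field d Ω)).continuous)

instance : CompleteSpace (formDomain d Ω bc) := isClosed_formDomain.completeSpace_coe

variable (d Ω bc) in
/-- The inclusion of the form domain, with the graph norm, in `X`. -/
def formState : formDomain d Ω bc →L[ℝ] stateSpace d Ω bc :=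
  ((WithLp.fstL 2 ℝ (L2 d Ω) (L2Field d Ω)).comp (formDomain d Ω bc).subtypeL).codRestrict
    (stateSpace d Ω bc) fun u => u.2.2

variable (d Ω bc) in
/-- The weak gradient on the form domain, with the graph norm. -/
def formGrad : formDomain d Ω bc →L[ℝ] L2Field d Ω :=
  (WithLp.sndL 2 ℝ (L2 d Ω) (L2Field d Ω)).comp (formDomain d Ω bc).subtypeL

theorem graphCoercive_form : GraphCoercive (formState d Ω bc) (formGrad d Ω bc) := fun h =>
  (WithLp.prod_norm_sq_eq_of_L2 (h : WithLp 2 (L2 d Ω × L2Field d Ω))).le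

theorem norm_formGrad_le (h : formDomain d Ω bc) : ‖formGrad d Ω bc h‖ ≤ ‖h‖ := by
  refine le_of_sq_le_sq ?_ (norm_nonneg _)
  have := WithLp.prod_norm_sq_eq_of_L2 (h : WithLp 2 (L2 d Ω × L2Field d Ω))
  calc _ ≤ ‖(h : WithLp 2 (L2 d Ω × L2Field d Ω)).fst‖ ^ 2
        + ‖(h : WithLp 2 (L2 d Ω × L2Field d Ω)).snd‖ ^ 2 := le_add_of_nonneg_left (sq_nonneg _)
    _ = _ := this.symm

variable (d Ω bc) in
/-- The identity map from the form domain, with the graph norm, to `D(A^{1/2})`. -/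
def ofForm : formDomain d Ω bc →L[ℝ] EnergySpace d Ω bc :=
  LinearMap.mkContinuous
    ({ toFun := fun h => h
       map_add' := fun _ _ => rfl
       map_smul' := fun _ _ => rfl } : formDomain d Ω bc →ₗ[ℝ] EnergySpace d Ω bc) 1
    fun h => by rw [one_mul]; exact norm_formGrad_le h

theorem grad_ofForm (h : formDomain d Ω bc) : grad (ofForm d Ω bc h) = formGrad d Ω bc h := rfl

theorem toState_ofForm (h : formDomain d Ω bc) :
    toState (ofForm d Ω bc h) = formState d Ω bc h := rfl

theorem ofForm_surjective : Function.Surjective (ofForm d Ω bc) := fun h => ⟨h, rfl⟩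

variable (d Ω bc) in
/-- The weak gradient as a continuous map on `D(A^{1/2})`. -/
def gradL : EnergySpace d Ω bc →L[ℝ] L2Field d Ω :=
  LinearMap.mkContinuous grad 1 fun u => by rw [one_mul, norm_eq]

variable (d Ω bc) in
/-- The operator `A : D(A^{1/2}) → D(A^{1/2})'`. -/
def laplaceDual : EnergySpace d Ω bc →L[ℝ] DualEnergySpace d Ω bc :=
  (innerSL ℝ).bilinearComp (gradL d Ω bc) (gradL d Ω bc)

theorem laplaceDual_apply (u φ : EnergySpace d Ω bc) :
    laplaceDual d Ω bc u φ = inner ℝ (grad u) (grad φ) := by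
  simp [laplaceDual, gradL]

/-- Cauchy-Schwarz in one direction, testing against `u` in the other. -/
theorem norm_laplaceDual (u : EnergySpace d Ω bc) : ‖laplaceDual d Ω bc u‖ = ‖u‖ := by
  refine le_antisymm (ContinuousLinearMap.opNorm_le_bound _ (norm_nonneg _) fun φ => ?_) ?_
  · rw [laplaceDual_apply, norm_eq, norm_eq]
    exact norm_inner_le_norm _ _
  · rcases (norm_nonneg u).eq_or_lt with h | h
    · rw [← h]; exact norm_nonneg _
    · refine le_of_mul_le_mul_right ?_ h
      have := (laplaceDual d Ω bc u).le_opNorm u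
      rw [laplaceDual_apply, real_inner_self_eq_norm_sq, ← norm_eq] at this
      rwa [Real.norm_of_nonneg (sq_nonneg _), sq] at this

/-- The time derivative of an energy solution is a weak solution. -/
theorem IsEnergySolution.isWeakSolution_deriv {u : ℝ → EnergySpace d Ω bc}
    {u' : ℝ → stateSpace d Ω bc} (hu : IsEnergySolution u u') :
    IsWeakSolution u' fun t => -laplaceDual d Ω bc (u t) where
  continuous := hu.continuous_deriv
  hasDerivAt φ t := by
    rw [neg_apply, laplaceDual_apply]
    exact hu.wave φ t
  continuous_deriv := ((laplaceDual d Ω bc).continuous.comp hu.continuous).neg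
  wave φ f hφ t := by
    have h := ((hu.hasDerivAt t).inner ℝ (hasDerivAt_const t f)).neg
    simp only [inner_zero_right, zero_add] at h
    refine h.congr_of_eventuallyEq (Filter.Eventually.of_forall fun s => ?_)
    simp only [neg_apply, laplaceDual_apply, Pi.neg_apply]
    rw [real_inner_comm, hφ, real_inner_comm]

theorem EnergyObservable.of_weakObservable {Q : Set (ℝ × M)} {T : ℝ}
    (h : WeakObservable d Ω bc Q T) : EnergyObservable d Ω bc Q T := by
  obtain ⟨C, hC, h⟩ := h
  refine ⟨C, hC, ?_⟩
  rintro _ _ u u' hu rfl rfl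
  have := h _ _ _ _ hu.isWeakSolution_deriv rfl rfl
  rwa [norm_neg, norm_laplaceDual, add_comm] at this

/-! ### Regularization of weak solutions. -/

/-- An element of `D(A^{1/2})'` as a linear form on the form domain with the graph norm. -/
def restrictDual : DualEnergySpace d Ω bc →L[ℝ] StrongDual ℝ (formDomain d Ω bc) :=
  (ofForm d Ω bc).precomp ℝ

theorem restrictDual_apply (ℓ : DualEnergySpace d Ω bc) (φ : formDomain d Ω bc) :
    restrictDual ℓ φ = ℓ (ofForm d Ω bc φ) := rfl

local notation "ι₀" => formState d Ω bc
local notation "g₀" => formGrad d Ω bc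

/-- If `u` is a weak solution, then `-(A + ε)⁻¹ u'` is an energy solution, with time derivative
`A (A + ε)⁻¹ u`. -/
theorem IsWeakSolution.isEnergySolution_resolvent {u : ℝ → stateSpace d Ω bc}
    {u' : ℝ → DualEnergySpace d Ω bc} (hu : IsWeakSolution u u') {ε : ℝ} (hε : 0 < ε) :
    IsEnergySolution (fun t => -ofForm d Ω bc (resolvent ι₀ g₀ ε (restrictDual (u' t))))
      fun t => u t - ε • ι₀ (pivotResolvent ι₀ g₀ ε (u t)) := by
  have hc := graphCoercive_form (d := d) (Ω := Ω) (bc := bc)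
  have hcont : Continuous fun t => u t - ε • ι₀ (pivotResolvent ι₀ g₀ ε (u t)) :=
    hu.continuous.sub 
      (((formState d Ω bc).continuous.comp
        ((pivotResolvent ι₀ g₀ ε).continuous.comp hu.continuous)).const_smul ε)
  refine ⟨?_, ?_, hcont, ?_⟩
  · exact ((ofForm d Ω bc).continuous.comp ((resolvent ι₀ g₀ ε).continuous.comp
      (restrictDual.continuous.comp hu.continuous_deriv))).neg
  · refine hasDerivAt_of_forall_inner hcont fun f t => ?_
    -- Any `f` in `X` may be moved onto the test function: `(A + ε)⁻¹ f` is in `D(A)`, so the wave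
    -- equation of `u` may be tested with it.
    have hL : IsLaplace (ofForm d Ω bc (pivotResolvent ι₀ g₀ ε f))
        (f - ε • ι₀ (pivotResolvent ι₀ g₀ ε f)) := fun ψ => by
      obtain ⟨ψ, rfl⟩ := ofForm_surjective ψ
      exact hc.inner_grad_pivotResolvent hε f ψ
    have h := (hu.wave _ _ hL t).neg
    rw [neg_neg, ← hc.inner_sub_smul_pivotResolvent_comm hε] at h
    refine h.congr_of_eventuallyEq (Filter.Eventually.of_forall fun s => ?_)
    simp only [map_neg, toState_ofForm, inner_neg_left, Pi.neg_apply]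
    rw [hc.inner_resolvent hε, restrictDual_apply]
  · intro φ t
    obtain ⟨φ, rfl⟩ := ofForm_surjective φ
    have h := (hu.hasDerivAt (ofForm d Ω bc φ) t).sub
      ((hu.hasDerivAt (ofForm d Ω bc (pivotResolvent ι₀ g₀ ε (ι₀ φ))) t).const_mul ε)
    have h1 : u' t (ofForm d Ω bc φ) - ε * u' t (ofForm d Ω bc (pivotResolvent ι₀ g₀ ε (ι₀ φ))) =
        -inner ℝ (grad (-ofForm d Ω bc (resolvent ι₀ g₀ ε (restrictDual (u' t)))))
          (grad (ofForm d Ω bc φ)) := by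
      have h2 := hc.shiftedForm_resolvent hε (restrictDual (u' t)) φ
      have h3 := hc.inner_resolvent hε (restrictDual (u' t)) (ι₀ φ)
      rw [shiftedForm_apply, restrictDual_apply] at h2
      rw [restrictDual_apply] at h3
      rw [map_neg, inner_neg_left, grad_ofForm, grad_ofForm, ← h2, ← h3]
      ring
    rw [← h1]
    refine h.congr_of_eventuallyEq (Filter.Eventually.of_forall fun s => ?_)
    simp only [Pi.sub_apply, toState_ofForm, inner_sub_left]
    rw [hc.inner_smul_pivotResolvent hε]

/-- An affine function of time with values in the kernel of `A` may be added to an energy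
solution. -/
theorem IsEnergySolution.add_kernel {u : ℝ → EnergySpace d Ω bc}
    {u' : ℝ → stateSpace d Ω bc} (hu : IsEnergySolution u u') {φ : EnergySpace d Ω bc}
    (hφ : grad φ = 0) :
    IsEnergySolution (fun t => u t + t • φ) fun t => u' t + toState φ where
  continuous := hu.continuous.add (continuous_id.smul continuous_const)
  hasDerivAt t := by
    have h := (hu.hasDerivAt t).add ((hasDerivAt_id t).smul_const (toState φ))
    rw [one_smul] at h
    refine h.congr_of_eventuallyEq (Filter.Eventually.of_forall fun s => ?_)
    simp
  continuous_deriv := hu.continuous_deriv.add continuous_const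
  wave ψ t := by
    have h := (hu.wave ψ t).add_const (inner ℝ (toState φ) (toState ψ))
    rw [map_add, map_smul, hφ, smul_zero, add_zero]
    simpa only [inner_add_left] using h

/-- The component of a weak solution in the kernel of `A` is constant. -/
theorem IsWeakSolution.inner_kernel_eq {u : ℝ → stateSpace d Ω bc}
    {u' : ℝ → DualEnergySpace d Ω bc} (hu : IsWeakSolution u u') {φ : EnergySpace d Ω bc}
    (hφ : grad φ = 0) (t s : ℝ) : inner ℝ (u t) (toState φ) = inner ℝ (u s) (toState φ) := by
  refine is_const_of_deriv_eq_zero (fun r => (hu.hasDerivAt φ r).differentiableAt)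
    (fun r => ?_) t s
  rw [(hu.hasDerivAt φ r).deriv]
  -- Continuity for the gradient seminorm forces `u' r` to vanish on the kernel.
  have h := (u' r).le_opNorm φ
  rw [norm_eq, hφ, norm_zero, mul_zero] at h
  exact norm_le_zero_iff.1 h

/-! ### Passage to the limit. -/

theorem lintegral_enorm_sq_eq (f : L2 d Ω) :
    ∫⁻ x in Ω, ‖f x‖ₑ ^ 2 ∂(riemannianMeasure d M) = ‖f‖ₑ ^ 2 := by
  rw [Lp.enorm_def, eLpNorm_eq_lintegral_rpow_enorm_toReal two_ne_zero ENNReal.ofNat_ne_top]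
  rw [← ENNReal.rpow_natCast, ← ENNReal.rpow_mul]
  simp

theorem observation_le {Q : Set (ℝ × M)} {T : ℝ} {u w : ℝ → stateSpace d Ω bc}
    (hu : Continuous u) (hw : Continuous w) :
    observation Q T w ≤ 2 * observation Q T u + 2 * ∫⁻ t in Ioo 0 T, ‖w t - u t‖ₑ ^ 2 := by
  have hsq : ∀ a b : ℝ≥0∞, (a + b) ^ 2 ≤ 2 * a ^ 2 + 2 * b ^ 2 := fun a b => by
    have := ENNReal.rpow_add_le_mul_rpow_add_rpow a b (p := 2) one_le_two
    norm_num at this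
    rwa [mul_add] at this
  -- Splitting the integral needs measurability of one summand only, so none is required of the
  -- observed integrals over the slices.
  have hmeas : Measurable fun t => ‖w t - u t‖ₑ ^ 2 := (hw.sub hu).enorm.measurable.pow_const 2
  rw [observation, observation, ← lintegral_const_mul' _ _ ENNReal.ofNat_ne_top,
    ← lintegral_const_mul' _ _ ENNReal.ofNat_ne_top, ← lintegral_add_right _ (hmeas.const_mul 2)]
  refine lintegral_mono fun t => ?_
  have hle : (riemannianMeasure d M).restrict (slice Q Ω t) ≤
      (riemannianMeasure d M).restrict Ω := Measure.restrict_mono_set _ fun x hx => hx.1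
  have hm : AEMeasurable (fun x => 2 * ‖((w t - u t : stateSpace d Ω bc) : L2 d Ω) x‖ₑ ^ 2)
      ((riemannianMeasure d M).restrict (slice Q Ω t)) :=
    (((Lp.aestronglyMeasurable _).mono_measure hle).enorm.pow_const 2).const_mul 2
  calc _ ≤ ∫⁻ x in slice Q Ω t, (2 * ‖(u t : L2 d Ω) x‖ₑ ^ 2 +
        2 * ‖((w t - u t : stateSpace d Ω bc) : L2 d Ω) x‖ₑ ^ 2) ∂(riemannianMeasure d M) := by
        refine lintegral_mono_ae ?_
        have h := Lp.coeFn_sub (w t : L2 d Ω) (u t : L2 d Ω)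
        filter_upwards [ae_mono hle h] with x hx
        refine le_trans ?_ (hsq _ _)
        gcongr
        rw [Submodule.coe_sub, hx, Pi.sub_apply]
        calc _ = ‖(u t : L2 d Ω) x + ((w t : L2 d Ω) x - (u t : L2 d Ω) x)‖ₑ := by
              rw [add_sub_cancel]
          _ ≤ _ := enorm_add_le _ _
    _ = 2 * ∫⁻ x in slice Q Ω t, ‖(u t : L2 d Ω) x‖ₑ ^ 2 ∂(riemannianMeasure d M) +
        2 * ∫⁻ x in slice Q Ω t, ‖((w t - u t : stateSpace d Ω bc) : L2 d Ω) x‖ₑ ^ 2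
          ∂(riemannianMeasure d M) := by
        rw [lintegral_add_right' _ hm, lintegral_const_mul' _ _ ENNReal.ofNat_ne_top,
          lintegral_const_mul' _ _ ENNReal.ofNat_ne_top]
    _ ≤ _ := by
        gcongr
        refine (lintegral_mono' hle le_rfl).trans ?_
        exact (lintegral_enorm_sq_eq _).le

/-- The norm of the regularized data controls the dual norm in the limit. -/
theorem eventually_le_norm_resolvent (ℓ : DualEnergySpace d Ω bc) {m : ℝ} (hm : m < ‖ℓ‖) :
    ∀ᶠ ε : ℝ in 𝓝[>] 0, m ≤ ‖g₀ (resolvent ι₀ g₀ ε (restrictDual ℓ))‖ := by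
  have hc := graphCoercive_form (d := d) (Ω := Ω) (bc := bc)
  rcases lt_or_ge m 0 with hm0 | hm0
  · exact Filter.Eventually.of_forall fun ε => hm0.le.trans (norm_nonneg _)
  -- With `v = (A + ε)⁻¹ ℓ`, `ℓ ψ` is `⟪∇v, ∇ψ⟫` plus `ε ⟪v, ψ⟫ = ℓ (ε (A + ε)⁻¹ ψ)`, and the last
  -- term is of order `√ε`.
  obtain ⟨ψ, hψ⟩ : ∃ ψ, m * ‖ψ‖ < ‖ℓ ψ‖ := by
    by_contra! h
    exact hm.not_ge (ℓ.opNorm_le_bound hm0 h)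
  obtain ⟨ψ, rfl⟩ := ofForm_surjective ψ
  have hgψ : 0 < ‖g₀ ψ‖ := by
    by_contra! h
    have h0 : ‖ofForm d Ω bc ψ‖ = 0 := le_antisymm h (norm_nonneg _)
    have h1 := ℓ.le_opNorm (ofForm d Ω bc ψ)
    rw [h0, mul_zero] at h1 hψ
    exact absurd hψ h1.not_gt
  have hlim : Filter.Tendsto (fun ε : ℝ => ‖ℓ‖ * Real.sqrt (ε * ‖ι₀ ψ‖ ^ 2)) (𝓝[>] 0) (𝓝 0) := by
    have : Continuous fun ε : ℝ => ‖ℓ‖ * Real.sqrt (ε * ‖ι₀ ψ‖ ^ 2) := by fun_prop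
    simpa using (this.tendsto 0).mono_left nhdsWithin_le_nhds
  have hψ' : 0 < ‖ℓ (ofForm d Ω bc ψ)‖ - m * ‖g₀ ψ‖ := sub_pos.2 hψ
  filter_upwards [self_mem_nhdsWithin, hlim.eventually (gt_mem_nhds hψ')] with ε hε hlt
  have hε : 0 < ε := hε
  set v := resolvent ι₀ g₀ ε (restrictDual ℓ) with hv
  have h1 := hc.shiftedForm_resolvent hε (restrictDual ℓ) ψ
  have h2 := hc.inner_resolvent hε (restrictDual ℓ) (ι₀ ψ)
  rw [shiftedForm_apply, ← hv, restrictDual_apply] at h1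
  rw [← hv, restrictDual_apply] at h2
  have h3 : ‖ε * inner ℝ (ι₀ v) (ι₀ ψ)‖ ≤ ‖ℓ‖ * Real.sqrt (ε * ‖ι₀ ψ‖ ^ 2) := by
    rw [h2, ← smul_eq_mul, ← map_smul, ← map_smul]
    refine (ℓ.le_opNorm _).trans ?_
    gcongr
    exact Real.le_sqrt_of_sq_le (hc.norm_grad_smul_pivotResolvent_sq_le hε (ι₀ ψ))
  have h4 : ‖ℓ (ofForm d Ω bc ψ)‖ ≤ ‖g₀ v‖ * ‖g₀ ψ‖ + ‖ℓ‖ * Real.sqrt (ε * ‖ι₀ ψ‖ ^ 2) := by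
    rw [← h1]
    exact (norm_add_le _ _).trans (add_le_add (norm_inner_le_norm _ _) h3)
  refine le_of_mul_le_mul_right ?_ hgψ
  linarith

theorem WeakObservable.of_energyObservable {Q : Set (ℝ × M)} {T : ℝ}
    (h : EnergyObservable d Ω bc Q T) : WeakObservable d Ω bc Q T := by
  obtain ⟨C, hC, h⟩ := h
  -- The loss of 2 comes from `observation_le`.
  refine ⟨C / 2, half_pos hC, ?_⟩
  rintro _ _ u u' hu rfl rfl
  have hc := graphCoercive_form (d := d) (Ω := Ω) (bc := bc)
  obtain ⟨φ, hφ, hP⟩ := hc.exists_kernel_projection (u 0)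
  set p := ι₀ φ with hp
  set w : ℝ → ℝ → stateSpace d Ω bc := fun ε t =>
    u t - ε • ι₀ (pivotResolvent ι₀ g₀ ε (u t)) + p with hw
  set v : ℝ → ℝ → EnergySpace d Ω bc := fun ε t =>
    -ofForm d Ω bc (resolvent ι₀ g₀ ε (restrictDual (u' t))) + t • ofForm d Ω bc φ with hv
  have hsol : ∀ ε, 0 < ε → IsEnergySolution (v ε) (w ε) := fun ε hε =>
    (hu.isEnergySolution_resolvent hε).add_kernel (φ := ofForm d Ω bc φ) hφ
  have hlim : ∀ t, Filter.Tendsto (fun ε => w ε t) (𝓝[>] 0) (𝓝 (u t)) := fun t => by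
    -- `u t - u 0` is orthogonal to the kernel, so the limit `p` found at time 0 serves for all `t`.
    have h1 := hc.tendsto_smul_pivotResolvent_zero (x := u t - u 0) fun ψ hψ => by
      rw [inner_sub_left, sub_eq_zero]
      exact hu.inner_kernel_eq (φ := ofForm d Ω bc ψ) hψ t 0
    have h2 := ((h1.add hP).const_sub (u t)).add_const p
    rw [zero_add, sub_add_cancel] at h2
    refine h2.congr fun ε => ?_
    rw [hw, ← smul_add, ← map_add, ← map_add, sub_add_cancel]
  have hres : Filter.Tendsto (fun ε => ∫⁻ t in Ioo 0 T, ‖w ε t - u t‖ₑ ^ 2) (𝓝[>] 0) (𝓝 0) := by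
    obtain ⟨B, hB⟩ := isCompact_Icc.exists_bound_of_continuousOn
      (hu.continuous.continuousOn (s := Icc 0 T))
    have hd := tendsto_lintegral_filter_of_dominated_convergence
      (μ := volume.restrict (Ioo (0 : ℝ) T)) (l := 𝓝[>] (0 : ℝ))
      (F := fun ε t => ‖w ε t - u t‖ₑ ^ 2) (f := fun _ => 0)
      (fun _ => ENNReal.ofReal (B + ‖p‖) ^ 2) ?_ ?_ ?_ ?_
    · simpa using hd
    · filter_upwards [self_mem_nhdsWithin] with ε hε
      exact ((hsol ε hε).continuous_deriv.sub hu.continuous).enorm.measurable.pow_const 2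
    · filter_upwards [self_mem_nhdsWithin] with ε hε
      refine (ae_restrict_mem measurableSet_Ioo).mono fun t ht => ?_
      gcongr
      rw [← ofReal_norm]
      refine ENNReal.ofReal_le_ofReal ?_
      calc ‖w ε t - u t‖ = ‖p - ε • ι₀ (pivotResolvent ι₀ g₀ ε (u t))‖ := by
            simp only [hw]; congr 1; abel
        _ ≤ ‖p‖ + ‖ε • ι₀ (pivotResolvent ι₀ g₀ ε (u t))‖ := norm_sub_le _ _
        _ ≤ ‖p‖ + B := by
            gcongr
            exact (hc.norm_smul_pivotResolvent_le hε _).trans (hB t (Ioo_subset_Icc_self ht))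
        _ = _ := add_comm _ _
    · rw [setLIntegral_const]
      exact ENNReal.mul_ne_top (by finiteness) (by simp)
    · exact Filter.Eventually.of_forall fun t => tendsto_enorm_sub_sq_zero (hlim t)
  -- The truncation `max m 0` keeps squaring monotone when `m` is negative; afterwards `m` increases
  -- to `‖u' 0‖`.
  have hlow : ∀ m < ‖u' 0‖,
      ENNReal.ofReal (C * (max m 0 ^ 2 + ‖u 0‖ ^ 2)) ≤ 2 * observation Q T u := fun m hm => by
    have hleft : Filter.Tendsto (fun ε => ENNReal.ofReal (C * (max m 0 ^ 2 + ‖w ε 0‖ ^ 2))) (𝓝[>] 0)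
        (𝓝 (ENNReal.ofReal (C * (max m 0 ^ 2 + ‖u 0‖ ^ 2)))) :=
      ENNReal.tendsto_ofReal ((((hlim 0).norm.pow 2).const_add _).const_mul C)
    have hright : Filter.Tendsto (fun ε => 2 * observation Q T u +
        2 * ∫⁻ t in Ioo 0 T, ‖w ε t - u t‖ₑ ^ 2) (𝓝[>] 0) (𝓝 (2 * observation Q T u)) := by
      have := (ENNReal.Tendsto.const_mul (a := 2) hres (Or.inr ENNReal.ofNat_ne_top)).const_add
        (2 * observation Q T u)
      simpa using this
    refine le_of_tendsto_of_tendsto hleft hright ?_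
    filter_upwards [self_mem_nhdsWithin, eventually_le_norm_resolvent (u' 0) hm] with ε hε hmε
    refine le_trans ?_ ((h _ _ _ _ (hsol ε hε) rfl rfl).trans
      (observation_le hu.continuous (hsol ε hε).continuous_deriv))
    refine ENNReal.ofReal_le_ofReal ?_
    have hv0 : max m 0 ≤ ‖v ε 0‖ := by
      refine max_le ?_ (norm_nonneg _)
      simp only [hv, zero_smul, add_zero, norm_neg]
      exact hmε
    gcongr
  have hfull : ENNReal.ofReal (C * (‖u' 0‖ ^ 2 + ‖u 0‖ ^ 2)) ≤ 2 * observation Q T u := by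
    have hcont : Continuous fun m => ENNReal.ofReal (C * (max m 0 ^ 2 + ‖u 0‖ ^ 2)) :=
      ENNReal.continuous_ofReal.comp (by fun_prop)
    have ht := (hcont.tendsto ‖u' 0‖).mono_left (nhdsWithin_le_nhds (s := Iio ‖u' 0‖))
    rw [max_eq_left (norm_nonneg _)] at ht
    exact le_of_tendsto ht (Filter.Eventually.mono self_mem_nhdsWithin hlow)
  rw [div_mul_eq_mul_div, add_comm, ENNReal.ofReal_div_of_pos two_pos]
  refine ENNReal.div_le_of_le_mul' ?_
  simpa using hfull

end Wave

end WaveObservability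

end

theorem mainTheorem7 {d : ℕ} (hd : 1 ≤ d)
    {M : Type*} [TopologicalSpace M] [T2Space M] [SecondCountableTopology M] [Nonempty M]
    [ChartedSpace (EuclideanSpace ℝ (Fin d)) M] [IsManifold (𝓡 d) ∞ M]
    [RiemannianBundle (fun x : M => TangentSpace (𝓡 d) x)]
    [IsContMDiffRiemannianBundle (𝓡 d) ∞ (EuclideanSpace ℝ (Fin d))
      (fun x : M => TangentSpace (𝓡 d) x)]
    [MeasurableSpace M] [BorelSpace M]
    (Ω : Set M) (hΩ_open : IsOpen Ω) (hΩ_conn : IsConnected Ω)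
    (hΩ_bdd : IsCompact (closure Ω)) (hΩ_bdry : WaveObservability.HasSmoothBoundary d Ω)
    (bc : WaveObservability.BoundaryCondition)
    (Q : Set (ℝ × M)) (hQ : ∃ U : Set (ℝ × M), IsOpen U ∧ Q = U ∩ (univ ×ˢ closure Ω))
    (T : ℝ) (hT : 0 < T) :
    WaveObservability.EnergyObservable d Ω bc Q T ↔
      WaveObservability.WeakObservable d Ω bc Q T :=
  ⟨WaveObservability.WeakObservable.of_energyObservable,
    WaveObservability.EnergyObservable.of_weakObservable⟩
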